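/- **Setting.** Let $\mathcal A$ and $\mathcal B$ be categories with equalizers, let $\mathcal T$ be a category, and let $(N_A:\mathcal A\to\mathcal T,\ R_A:\mathcal T\to\mathcal A)$ and $(N_B:\mathcal B\to\mathcal T,\ R_B:\mathcal T\to\mathcal B)$ be adjunctions ($N$ left adjoint to $R$) with units $\eta^A,\eta^B$ and counits $\epsilon^A,\epsilon^B$. Juxtaposition denotes composition of functors, and horizontal composition of natural transformations. An adjunction $(N,R)$ is called *regular* if its unit is a regular monomorphism in the category of functors and natural transformations (i.e. the equalizer there of some parallel pair) and $N$ preserves equalizers. A *pre-torsor* over the two adjunctions is a natural transformation $\tau:R_AN_B\to R_AN_BR_BN_AR_AN_B$ such that $$(R_AN_BR_B\epsilon^AN_B)\circ\tau=R_AN_B\eta^B,\qquad (R_A\epsilon^BN_AR_AN_B)\circ\tau=\eta^AR_AN_B,$$ $$(R_AN_BR_BN_A\tau)\circ\tau=(\tau R_BN_AR_AN_B)\circ\tau .$$ It is *regular* if both adjunctions are regular. A *comonad arrow* from a comonad $\mathbb C=(C,\Delta,\varepsilon)$ on $\mathcal K$ to a comonad $\mathbb C'=(C',\Delta',\varepsilon')$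 on $\mathcal K'$ is a functor $F:\mathcal K'\to\mathcal K$ with a natural transformation $\xi:CF\to FC'$ such that $(F\varepsilon')\circ\xi=\varepsilon F$ and $(F\Delta')\circ\xi=(\xi C')\circ(C\xi)\circ(\Delta F)$. It is *regular* if $\xi$ is an isomorphism, and *co-regular* if $F$ has a left adjoint $G$ (with unit $\eta$ and counit $\epsilon$) and $(\epsilon C'G)\circ(G\xi G)\circ(GC\eta):GC\to C'G$ is an isomorphism. **The associated comonads.** A regular pre-torsor $\tau$ determines the following two objects. 1. A comonad $\mathbb C=(C,\Delta^C,\varepsilon^C)$ on $\mathcal A$: the functor $C$, with $i:C\to R_AN_BR_BN_A$, is the equalizer, in the category of functors, of $$(R_AN_BR_BN_AR_A\epsilon^BN_A)\circ(\tau R_BN_A)\quad\text{and}\quad R_AN_BR_BN_A\eta^A,$$ and $\Delta^C,\varepsilon^C$ are determined by $(ii)\circ\Delta^C=(\tau R_BN_A)\circ i$ and $\eta^A\circ\varepsilon^C=(R_A\epsilon^BN_A)\circ i$. The functor $C$ preserves equalizers, and with $\xi=(R_AN_BR_B\epsilon^A)\circ(iR_A):CR_A\to R_AN_BR_B$ the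 pair $(R_A,\xi)$ is a regular comonad arrow from $\mathbb C$ to the comonad $N_BR_B$ on $\mathcal T$. 2. A comonad $\mathbb D=(D,\Delta^D,\varepsilon^D)$ on $\mathcal B$: the functor $D$, with $j:D\to R_BN_AR_AN_B$, is the equalizer, in the category of functors, of $$(R_B\epsilon^AN_BR_BN_AR_AN_B)\circ(R_BN_A\tau)\quad\text{and}\quad \eta^BR_BN_AR_AN_B,$$ and $\Delta^D,\varepsilon^D$ are determined by $(jj)\circ\Delta^D=(R_BN_A\tau)\circ j$ and $\eta^B\circ\varepsilon^D=(R_B\epsilon^AN_B)\circ j$. The functor $D$ preserves equalizers, and with $\zeta=(R_BN_AR_A\epsilon^B)\circ(jR_B):DR_B\to R_BN_AR_A$ the pair $(R_B,\zeta)$ is a co-regular comonad arrow from $\mathbb D$ to the comonad $N_AR_A$ on $\mathcal T$. **Corollary 5.4.** For every regular pre-torsor, the associated comonads $\mathbb C$ on $\mathcal A$ and $\mathbb D$ on $\mathcal B$ have equivalent (Eilenberg–Moore) categories of comodules: $\mathcal A^{\mathbb C}\simeq\mathcal B^{\mathbb D}$. -/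

import Mathlib

open CategoryTheory CategoryTheory.Limits

universe v₁ v₂ v₃ u₁ u₂ u₃

noncomputable section

namespace PreTorsors

section EqualizerHelpers

variable {K : Type u₁} [Category.{v₁} K]

/-- The fork `i` over the parallel pair `f`, `g` is an equalizer. -/
def IsEqualizer {E X Y : K} (i : E ⟶ X) (f g : X ⟶ Y) : Prop :=
  ∃ h : i ≫ f = i ≫ g, Nonempty (IsLimit (Fork.ofι i h))

namespace IsEqualizer

variable {E X Y : K} {i : E ⟶ X} {f g : X ⟶ Y}

theorem condition (h : IsEqualizer i f g) : i ≫ f = i ≫ g := h.1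

theorem mono (h : IsEqualizer i f g) : Mono i := by
  obtain ⟨_, ⟨hl⟩⟩ := h
  exact mono_of_isLimit_fork hl

theorem cancel (h : IsEqualizer i f g) {Z : K} {a b : Z ⟶ E} (hab : a ≫ i = b ≫ i) : a = b :=
  have := h.mono
  (cancel_mono i).1 hab

/-- The morphism induced by the universal property of an equalizer. -/
def lift (h : IsEqualizer i f g) {Z : K} (k : Z ⟶ X) (hk : k ≫ f = k ≫ g) : Z ⟶ E :=
  Fork.IsLimit.lift h.2.some k hk

@[simp] theorem lift_comp (h : IsEqualizer i f g) {Z : K} (k : Z ⟶ X) (hk : k ≫ f = k ≫ g) :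
    h.lift k hk ≫ i = k :=
  Fork.IsLimit.lift_ι' h.2.some k hk

theorem of_lift [Mono i] (w : i ≫ f = i ≫ g)
    (hl : ∀ {Z : K} (k : Z ⟶ X), k ≫ f = k ≫ g → ∃ l : Z ⟶ E, l ≫ i = k) :
    IsEqualizer i f g := by
  refine ⟨w, ⟨Fork.IsLimit.mk' _ fun s => ?_⟩⟩
  have hs := hl s.ι s.condition
  exact ⟨hs.choose, hs.choose_spec, fun {m} hm => by
    have h1 : m ≫ i = s.ι := hm
    rw [← cancel_mono i, h1, hs.choose_spec]⟩

theorem map (h : IsEqualizer i f g) {L : Type u₂} [Category.{v₂} L] (G : K ⥤ L)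
    [PreservesLimitsOfShape WalkingParallelPair G] :
    IsEqualizer (G.map i) (G.map f) (G.map g) :=
  ⟨_, ⟨isLimitForkMapOfIsLimit G h.1 h.2.some⟩⟩

theorem of_isLimit {c : Fork f g} (hc : IsLimit c) : IsEqualizer c.ι f g :=
  ⟨c.condition, ⟨hc.ofIsoLimit c.isoForkOfι⟩⟩

end IsEqualizer

theorem isEqualizer_ι (X Y : K) (f g : X ⟶ Y) [HasEqualizer f g] :
    IsEqualizer (equalizer.ι f g) f g :=
  ⟨_, ⟨equalizerIsEqualizer f g⟩⟩

variable {L : Type u₂} [Category.{v₂} L]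

theorem preservesEqualizers_of {F : K ⥤ L}
    (h : ∀ {E X Y : K} (i : E ⟶ X) (f g : X ⟶ Y), IsEqualizer i f g →
      IsEqualizer (F.map i) (F.map f) (F.map g)) :
    PreservesLimitsOfShape WalkingParallelPair F := by
  refine ⟨fun {D} => ?_⟩
  have key : ∀ {X Y : K} (f g : X ⟶ Y), PreservesLimit (parallelPair f g) F := by
    intro X Y f g
    refine ⟨fun {c} hc => ?_⟩
    have h1 := h _ _ _ (IsEqualizer.of_isLimit (c := c) hc)
    have h2 := (isLimitMapConeForkEquiv F (Fork.condition c)).symm h1.2.some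
    exact ⟨h2.ofIsoLimit ((Cone.functoriality _ F).mapIso (Fork.isoForkOfι c)).symm⟩
  have := key (D.map WalkingParallelPairHom.left) (D.map WalkingParallelPairHom.right)
  exact preservesLimit_of_iso_diagram F (diagramIsoParallelPair D).symm

variable [HasEqualizers L]

/-- Equalizers of natural transformations are computed objectwise. -/
theorem IsEqualizer.app {E G G' : K ⥤ L} {i : E ⟶ G} {f g : G ⟶ G'} (h : IsEqualizer i f g)
    (X : K) : IsEqualizer (i.app X) (f.app X) (g.app X) :=
  h.map ((evaluation K L).obj X)

/-- An equalizer of natural transformations between equalizer preserving functors preserves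
equalizers. -/
theorem preservesEqualizers_of_isEqualizer {E G G' : K ⥤ L} {i : E ⟶ G} {f g : G ⟶ G'}
    (h : IsEqualizer i f g) [PreservesLimitsOfShape WalkingParallelPair G]
    [PreservesLimitsOfShape WalkingParallelPair G'] :
    PreservesLimitsOfShape WalkingParallelPair E := by
  refine preservesEqualizers_of fun {U X Y} e a b he => ?_
  have hU := h.app U
  have hX := h.app X
  have := hU.mono
  have := hX.mono
  have := (he.map G).mono
  have : Mono (E.map e) := by
    have h1 : E.map e ≫ i.app X = i.app U ≫ G.map e := i.naturality e
    have : Mono (E.map e ≫ i.app X) := by rw [h1]; infer_instance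
    exact mono_of_mono _ (i.app X)
  refine IsEqualizer.of_lift (by rw [← E.map_comp, ← E.map_comp, he.condition]) ?_
  intro Z k hk
  have h1 : (k ≫ i.app X) ≫ G.map a = (k ≫ i.app X) ≫ G.map b := by
    rw [Category.assoc, Category.assoc, ← i.naturality, ← i.naturality, reassoc_of% hk]
  let y := (he.map G).lift _ h1
  have hy : y ≫ G.map e = k ≫ i.app X := (he.map G).lift_comp _ h1
  have h2 : y ≫ f.app U = y ≫ g.app U := by
    apply (he.map G').cancel
    rw [Category.assoc, Category.assoc, ← f.naturality, ← g.naturality, reassoc_of% hy,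
      reassoc_of% hy, hX.condition]
  refine ⟨hU.lift y h2, hX.cancel ?_⟩
  rw [Category.assoc, i.naturality, ← Category.assoc, hU.lift_comp, hy]

end EqualizerHelpers

section Adjunctions

variable {A : Type u₁} [Category.{v₁} A] {T : Type u₃} [Category.{v₃} T]

/-- An adjunction `N ⊣ R` is regular if its unit is a regular monomorphism in the category of
functors and natural transformations, and `N` preserves equalizers. -/
structure IsRegularAdjunction {N : A ⥤ T} {R : T ⥤ A} (adj : N ⊣ R) : Prop where
  unit_isRegularMono : IsRegularMono adj.unit
  preservesEqualizers : PreservesLimitsOfShape WalkingParallelPair N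

/-- If the unit `η` of an adjunction `N ⊣ R` is a regular natural monomorphism, then it is
the equalizer of `η R N` and `R N η`. -/
theorem isEqualizer_unit [HasEqualizers A] {N : A ⥤ T} {R : T ⥤ A} (adj : N ⊣ R)
    (h : IsRegularMono adj.unit) (X : A) :
    IsEqualizer (adj.unit.app X) (adj.unit.app (R.obj (N.obj X)))
      (R.map (N.map (adj.unit.app X))) := by
  obtain ⟨⟨hr⟩⟩ := h
  have he : IsEqualizer adj.unit hr.left hr.right := ⟨hr.w, ⟨hr.isLimit⟩⟩
  have hX := he.app X
  have := hX.mono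
  refine IsEqualizer.of_lift (adj.unit.naturality (adj.unit.app X)) ?_
  intro Z k hk
  have h1 : k ≫ hr.left.app X = k ≫ hr.right.app X := by
    apply (he.app _).cancel
    have n1 := adj.unit.naturality (hr.left.app X)
    have n2 := adj.unit.naturality (hr.right.app X)
    have h3 := congrArg (fun t => R.map (N.map t)) hX.condition
    simp only [Functor.id_obj, Functor.id_map, Functor.comp_obj, Functor.comp_map,
      Functor.map_comp] at n1 n2 h3 ⊢
    rw [Category.assoc, Category.assoc, n1, n2, reassoc_of% hk, reassoc_of% hk, h3]
  exact ⟨hX.lift k h1, hX.lift_comp k h1⟩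

end Adjunctions

section Setting

/-- Functors `P : A ⥤ B`, `Q : B ⥤ A`, `R : A ⥤ A`, `S : B ⥤ B` that preserve equalizers,
with natural transformations `r`, `s`, `w`, `z`, `τ`, for which the two comonads below are
constructed. It is only used for the functors that come from a pre-torsor. -/
structure Setting (A : Type u₁) [Category.{v₁} A] (B : Type u₂) [Category.{v₂} B] where
  P : A ⥤ B
  Q : B ⥤ A
  R : A ⥤ A
  S : B ⥤ B
  r : 𝟭 A ⟶ R
  s : 𝟭 B ⟶ S
  w : P ⋙ Q ⟶ R
  z : Q ⋙ P ⟶ S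
  τ : Q ⟶ Q ⋙ P ⋙ Q
  preservesP : PreservesLimitsOfShape WalkingParallelPair P
  preservesQ : PreservesLimitsOfShape WalkingParallelPair Q
  preservesR : PreservesLimitsOfShape WalkingParallelPair R
  preservesS : PreservesLimitsOfShape WalkingParallelPair S
  isEqualizer_r : ∀ X : A, IsEqualizer (r.app X) (r.app (R.obj X)) (R.map (r.app X))
  isEqualizer_s : ∀ Y : B, IsEqualizer (s.app Y) (s.app (S.obj Y)) (S.map (s.app Y))
  coassoc : ∀ Y : B, τ.app Y ≫ Q.map (P.map (τ.app Y)) = τ.app Y ≫ τ.app (P.obj (Q.obj Y))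
  τ_z : ∀ Y : B, τ.app Y ≫ Q.map (z.app Y) = Q.map (s.app Y)
  τ_w : ∀ Y : B, τ.app Y ≫ w.app (Q.obj Y) = r.app (Q.obj Y)

attribute [instance] Setting.preservesP Setting.preservesQ Setting.preservesR Setting.preservesS

namespace Setting

variable {A : Type u₁} [Category.{v₁} A] {B : Type u₂} [Category.{v₂} B]
variable (H : Setting A B)

/-- `ωˡ = (QPw) ∘ (τP)`. -/
@[simps] def ωl : H.P ⋙ H.Q ⟶ H.R ⋙ H.P ⋙ H.Q where
  app X := H.τ.app (H.P.obj X) ≫ H.Q.map (H.P.map (H.w.app X))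
  naturality X Y f := by
    have h1 := H.τ.naturality (H.P.map f)
    have h2 := congrArg (fun t => H.Q.map (H.P.map t)) (H.w.naturality f)
    simp only [Functor.comp_obj, Functor.comp_map, Functor.map_comp, Category.assoc] at h1 h2 ⊢
    rw [reassoc_of% h1, h2]

/-- `ωʳ = QPr`. -/
@[simps] def ωr : H.P ⋙ H.Q ⟶ H.R ⋙ H.P ⋙ H.Q where
  app X := H.Q.map (H.P.map (H.r.app X))
  naturality X Y f := by
    have h2 := congrArg (fun t => H.Q.map (H.P.map t)) (H.r.naturality f)
    simpa using h2

/-- `θˡ = (zPQ) ∘ (Pτ)`. -/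
@[simps] def θl : H.Q ⋙ H.P ⟶ H.Q ⋙ H.P ⋙ H.S where
  app Y := H.P.map (H.τ.app Y) ≫ H.z.app (H.P.obj (H.Q.obj Y))
  naturality X Y f := by
    have h1 := congrArg H.P.map (H.τ.naturality f)
    have h2 := H.z.naturality (H.P.map (H.Q.map f))
    simp only [Functor.comp_obj, Functor.comp_map, Functor.map_comp, Category.assoc] at h1 h2 ⊢
    rw [reassoc_of% h1, h2]

/-- `θʳ = sPQ`. -/
@[simps] def θr : H.Q ⋙ H.P ⟶ H.Q ⋙ H.P ⋙ H.S where
  app Y := H.s.app (H.P.obj (H.Q.obj Y))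
  naturality _ _ f := H.s.naturality (H.P.map (H.Q.map f))

theorem τ_naturality {X Y : B} (f : X ⟶ Y) :
    H.Q.map f ≫ H.τ.app Y = H.τ.app X ≫ H.Q.map (H.P.map (H.Q.map f)) :=
  H.τ.naturality f

theorem w_naturality {X Y : A} (f : X ⟶ Y) :
    H.Q.map (H.P.map f) ≫ H.w.app Y = H.w.app X ≫ H.R.map f :=
  H.w.naturality f

theorem z_naturality {X Y : B} (f : X ⟶ Y) :
    H.P.map (H.Q.map f) ≫ H.z.app Y = H.z.app X ≫ H.S.map f :=
  H.z.naturality f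

theorem r_naturality {X Y : A} (f : X ⟶ Y) : f ≫ H.r.app Y = H.r.app X ≫ H.R.map f :=
  H.r.naturality f

theorem s_naturality {X Y : B} (f : X ⟶ Y) : f ≫ H.s.app Y = H.s.app X ≫ H.S.map f :=
  H.s.naturality f

section C

variable [HasEqualizers A]

/-- The functor `C`, the equalizer of `ωˡ` and `ωʳ` in the category of functors. -/
def C : A ⥤ A := equalizer H.ωl H.ωr

/-- The canonical monomorphism `C ⟶ QP`. -/
def i : H.C ⟶ H.P ⋙ H.Q := equalizer.ι H.ωl H.ωr

theorem isEqualizer_i (X : A) :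
    IsEqualizer (H.i.app X) (H.ωl.app X) (H.ωr.app X) :=
  (isEqualizer_ι _ _ H.ωl H.ωr).app X

instance preservesC : PreservesLimitsOfShape WalkingParallelPair H.C :=
  preservesEqualizers_of_isEqualizer (isEqualizer_ι _ _ H.ωl H.ωr)

theorem i_condition (X : A) :
    H.i.app X ≫ H.τ.app (H.P.obj X) ≫ H.Q.map (H.P.map (H.w.app X)) =
      H.i.app X ≫ H.Q.map (H.P.map (H.r.app X)) :=
  (H.isEqualizer_i X).condition

theorem i_naturality {X Y : A} (f : X ⟶ Y) :
    H.C.map f ≫ H.i.app Y = H.i.app X ≫ H.Q.map (H.P.map f) :=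
  H.i.naturality f

/-- The left coaction `c : Q ⟶ CQ`, determined by `(iQ) ∘ c = τ`. -/
def c (Y : B) : H.Q.obj Y ⟶ H.C.obj (H.Q.obj Y) :=
  (H.isEqualizer_i (H.Q.obj Y)).lift (H.τ.app Y) (by
    simp only [ωl_app, ωr_app]
    rw [← reassoc_of% (H.coassoc Y), ← H.Q.map_comp, ← H.P.map_comp, H.τ_w])

theorem c_i (Y : B) : H.c Y ≫ H.i.app (H.Q.obj Y) = H.τ.app Y :=
  (H.isEqualizer_i _).lift_comp _ _

theorem isEqualizer_Ci (X : A) :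
    IsEqualizer (H.C.map (H.i.app X)) (H.C.map (H.ωl.app X)) (H.C.map (H.ωr.app X)) :=
  (H.isEqualizer_i X).map H.C

theorem δC_aux (X : A) :
    (H.i.app X ≫ H.c (H.P.obj X)) ≫ H.C.map (H.ωl.app X) =
      (H.i.app X ≫ H.c (H.P.obj X)) ≫ H.C.map (H.ωr.app X) := by
  apply (H.isEqualizer_i _).cancel
  have h := H.c_i (H.P.obj X)
  simp only [Category.assoc, Functor.comp_obj] at h ⊢
  rw [H.i_naturality, H.i_naturality, reassoc_of% h, reassoc_of% h]
  simp only [ωl_app, ωr_app, Functor.map_comp, Functor.comp_obj]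
  rw [reassoc_of% (H.coassoc (H.P.obj X)), ← H.τ_naturality, ← H.τ_naturality,
    reassoc_of% (H.i_condition X)]

/-- The component of the coproduct, determined by `(Ci) ∘ Δ = (cP) ∘ i`, equivalently by
`(ii) ∘ Δ = (τP) ∘ i`. -/
def δC (X : A) : H.C.obj X ⟶ H.C.obj (H.C.obj X) :=
  (H.isEqualizer_Ci X).lift _ (H.δC_aux X)

theorem δC_Ci (X : A) : H.δC X ≫ H.C.map (H.i.app X) = H.i.app X ≫ H.c (H.P.obj X) :=
  (H.isEqualizer_Ci X).lift_comp _ _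

theorem εC_aux (X : A) :
    (H.i.app X ≫ H.w.app X) ≫ H.r.app (H.R.obj X) =
      (H.i.app X ≫ H.w.app X) ≫ H.R.map (H.r.app X) := by
  simp only [Category.assoc]
  rw [H.r_naturality, ← H.w_naturality, ← reassoc_of% (H.i_condition X), H.w_naturality,
    reassoc_of% (H.τ_w (H.P.obj X))]
  rfl

/-- The component of the counit, determined by `r ∘ ε = w ∘ i`. -/
def εC (X : A) : H.C.obj X ⟶ X :=
  (H.isEqualizer_r X).lift _ (H.εC_aux X)

theorem εC_r (X : A) : H.εC X ≫ H.r.app X = H.i.app X ≫ H.w.app X :=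
  (H.isEqualizer_r X).lift_comp _ _

theorem c_coassoc (Y : B) : H.c Y ≫ H.C.map (H.c Y) = H.c Y ≫ H.δC (H.Q.obj Y) := by
  apply (H.isEqualizer_Ci _).cancel
  have h1 := H.c_i Y
  have h2 := H.c_i (H.P.obj (H.Q.obj Y))
  rw [Category.assoc, Category.assoc, H.δC_Ci, ← H.C.map_comp, h1]
  apply (H.isEqualizer_i _).cancel
  simp only [Category.assoc, Functor.comp_obj] at h1 h2 ⊢
  rw [H.i_naturality, reassoc_of% h1, h2, reassoc_of% h1, H.coassoc]

theorem c_counit (Y : B) : H.c Y ≫ H.εC (H.Q.obj Y) = 𝟙 _ := by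
  refine (H.isEqualizer_r (H.Q.obj Y)).cancel ?_
  have h1 := H.c_i Y
  have h2 := H.εC_r (H.Q.obj Y)
  have h3 := H.τ_w Y
  simp only [Category.assoc, Functor.comp_obj, Functor.id_obj] at h1 h2 h3 ⊢
  rw [h2, reassoc_of% h1, h3]
  exact (Category.id_comp _).symm

theorem δC_naturality {X Y : A} (f : X ⟶ Y) :
    H.C.map f ≫ H.δC Y = H.δC X ≫ H.C.map (H.C.map f) := by
  apply (H.isEqualizer_Ci _).cancel
  apply (H.isEqualizer_i _).cancel
  have h1 := H.c_i (H.P.obj X)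
  have h2 := H.c_i (H.P.obj Y)
  have h3 := H.δC_Ci X
  have h4 := H.δC_Ci Y
  have h5 := H.τ_naturality (H.P.map f)
  have h6 := congrArg H.C.map (H.i_naturality f)
  simp only [Category.assoc, Functor.comp_obj, Functor.map_comp] at h1 h2 h3 h4 h5 h6 ⊢
  rw [reassoc_of% h4, h2, reassoc_of% (H.i_naturality f), h5, reassoc_of% h6, H.i_naturality,
    reassoc_of% h3, reassoc_of% h1]

theorem εC_naturality {X Y : A} (f : X ⟶ Y) : H.C.map f ≫ H.εC Y = H.εC X ≫ f := by
  apply (H.isEqualizer_r _).cancel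
  have h1 := H.εC_r X
  have h2 := H.εC_r Y
  simp only [Functor.comp_obj] at h1 h2
  simp only [Category.assoc, Functor.id_obj]
  rw [h2, reassoc_of% (H.i_naturality f), H.w_naturality, H.r_naturality, reassoc_of% h1]

theorem c_naturality_δ (X : A) :
    H.δC X ≫ H.C.map (H.i.app X) ≫ H.i.app (H.Q.obj (H.P.obj X)) =
      H.i.app X ≫ H.τ.app (H.P.obj X) := by
  have h1 := H.c_i (H.P.obj X)
  have h3 := H.δC_Ci X
  simp only [Functor.comp_obj] at h1 h3
  rw [reassoc_of% h3, h1]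

/-- The comonad `(C, Δ, ε)` on `A`. -/
def comonadC : Comonad A where
  toFunctor := H.C
  ε := { app := H.εC, naturality := fun _ _ f => H.εC_naturality f }
  δ := { app := H.δC, naturality := fun _ _ f => H.δC_naturality f }
  coassoc X := by
    apply ((H.isEqualizer_Ci X).map H.C).cancel
    have h3 := H.δC_Ci X
    have h4 := H.δC_naturality (H.i.app X)
    have h5 := H.c_coassoc (H.P.obj X)
    simp only [Category.assoc, Functor.comp_obj] at h3 h4 h5 ⊢
    rw [← H.C.map_comp, h3, ← h4, H.C.map_comp, reassoc_of% h3, reassoc_of% h3, h5]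
  left_counit X := by
    apply (H.isEqualizer_i X).cancel
    have h3 := H.δC_Ci X
    have h4 := H.εC_naturality (H.i.app X)
    have h5 := H.c_counit (H.P.obj X)
    simp only [Category.assoc, Functor.comp_obj] at h3 h4 h5 ⊢
    rw [← h4, reassoc_of% h3, h5]
    simp
  right_counit X := by
    apply (H.isEqualizer_i X).cancel
    apply (((H.isEqualizer_r X).map H.P).map H.Q).cancel
    have h1 := H.εC_r X
    have h2 := H.c_naturality_δ X
    have h3 := H.i_naturality (H.i.app X)
    simp only [Category.assoc, Functor.comp_obj, Functor.id_obj] at h1 h2 h3 ⊢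
    rw [reassoc_of% (H.i_naturality (H.εC X)), ← H.Q.map_comp, ← H.P.map_comp, h1,
      H.P.map_comp, H.Q.map_comp, ← reassoc_of% h3, reassoc_of% h2, H.i_condition]
    simp

end C

section D

variable [HasEqualizers B]

/-- The functor `D`, the equalizer of `θˡ` and `θʳ` in the category of functors. -/
def D : B ⥤ B := equalizer H.θl H.θr

/-- The canonical monomorphism `D ⟶ PQ`. -/
def j : H.D ⟶ H.Q ⋙ H.P := equalizer.ι H.θl H.θr

theorem isEqualizer_j (Y : B) :
    IsEqualizer (H.j.app Y) (H.θl.app Y) (H.θr.app Y) :=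
  (isEqualizer_ι _ _ H.θl H.θr).app Y

instance preservesD : PreservesLimitsOfShape WalkingParallelPair H.D :=
  preservesEqualizers_of_isEqualizer (isEqualizer_ι _ _ H.θl H.θr)

theorem j_condition (Y : B) :
    H.j.app Y ≫ H.P.map (H.τ.app Y) ≫ H.z.app (H.P.obj (H.Q.obj Y)) =
      H.j.app Y ≫ H.s.app (H.P.obj (H.Q.obj Y)) :=
  (H.isEqualizer_j Y).condition

theorem j_naturality {X Y : B} (f : X ⟶ Y) :
    H.D.map f ≫ H.j.app Y = H.j.app X ≫ H.P.map (H.Q.map f) :=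
  H.j.naturality f

theorem isEqualizer_Qj (Y : B) :
    IsEqualizer (H.Q.map (H.j.app Y)) (H.Q.map (H.θl.app Y)) (H.Q.map (H.θr.app Y)) :=
  (H.isEqualizer_j Y).map H.Q

/-- The right coaction `d : Q ⟶ QD`, determined by `(Qj) ∘ d = τ`. -/
def d (Y : B) : H.Q.obj Y ⟶ H.Q.obj (H.D.obj Y) :=
  (H.isEqualizer_Qj Y).lift (H.τ.app Y) (by
    have h := H.τ_z (H.P.obj (H.Q.obj Y))
    simp only [θl_app, θr_app, Functor.map_comp]
    rw [reassoc_of% (H.coassoc Y), h])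

theorem d_Qj (Y : B) : H.d Y ≫ H.Q.map (H.j.app Y) = H.τ.app Y :=
  (H.isEqualizer_Qj Y).lift_comp _ _

theorem d_naturality {X Y : B} (f : X ⟶ Y) :
    H.Q.map f ≫ H.d Y = H.d X ≫ H.Q.map (H.D.map f) := by
  apply (H.isEqualizer_Qj _).cancel
  rw [Category.assoc, Category.assoc, H.d_Qj, ← H.Q.map_comp, H.j_naturality, H.Q.map_comp,
    reassoc_of% (H.d_Qj X), H.τ_naturality]

theorem δD_aux (Y : B) :
    (H.j.app Y ≫ H.P.map (H.d Y)) ≫ H.θl.app (H.D.obj Y) =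
      (H.j.app Y ≫ H.P.map (H.d Y)) ≫ H.θr.app (H.D.obj Y) := by
  apply ((((H.isEqualizer_j Y).map H.Q).map H.P).map H.S).cancel
  have h1 := H.θl.naturality (H.j.app Y)
  have h2 := H.θr.naturality (H.j.app Y)
  have h3 := congrArg H.P.map (H.d_Qj Y)
  have h4 := H.z_naturality (H.P.map (H.τ.app Y))
  have h5 := H.s_naturality (H.P.map (H.τ.app Y))
  have h6 := congrArg H.P.map (H.coassoc Y)
  simp only [Category.assoc, Functor.comp_obj, Functor.comp_map, Functor.map_comp, θl_app,
    θr_app] at h1 h2 h3 h4 h5 h6 ⊢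
  rw [← h1, ← h2, reassoc_of% h3, ← reassoc_of% h6, h4, reassoc_of% (H.j_condition Y),
    reassoc_of% h3, h5]

/-- The component of the coproduct, determined by `(jD) ∘ Δ = (Pd) ∘ j`, equivalently by
`(jj) ∘ Δ = (Pτ) ∘ j`. -/
def δD (Y : B) : H.D.obj Y ⟶ H.D.obj (H.D.obj Y) :=
  (H.isEqualizer_j (H.D.obj Y)).lift _ (H.δD_aux Y)

theorem δD_j (Y : B) : H.δD Y ≫ H.j.app (H.D.obj Y) = H.j.app Y ≫ H.P.map (H.d Y) :=
  (H.isEqualizer_j _).lift_comp _ _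

theorem εD_aux (Y : B) :
    (H.j.app Y ≫ H.z.app Y) ≫ H.s.app (H.S.obj Y) =
      (H.j.app Y ≫ H.z.app Y) ≫ H.S.map (H.s.app Y) := by
  have h1 := H.z_naturality (H.z.app Y)
  have h2 := congrArg H.P.map (H.τ_z Y)
  have h3 := H.z_naturality (H.s.app Y)
  simp only [Category.assoc, Functor.comp_obj, Functor.map_comp, Functor.id_obj] at h1 h2 h3 ⊢
  rw [H.s_naturality, ← reassoc_of% (H.j_condition Y), ← h1, reassoc_of% h2, h3]

/-- The component of the counit, determined by `s ∘ ε = z ∘ j`. -/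
def εD (Y : B) : H.D.obj Y ⟶ Y :=
  (H.isEqualizer_s Y).lift _ (H.εD_aux Y)

theorem εD_s (Y : B) : H.εD Y ≫ H.s.app Y = H.j.app Y ≫ H.z.app Y :=
  (H.isEqualizer_s Y).lift_comp _ _

theorem d_coassoc (Y : B) : H.d Y ≫ H.Q.map (H.δD Y) = H.d Y ≫ H.d (H.D.obj Y) := by
  apply (H.isEqualizer_Qj _).cancel
  apply (((H.isEqualizer_Qj Y).map H.P).map H.Q).cancel
  have h1 := congrArg H.Q.map (H.δD_j Y)
  have h2 := congrArg (fun t => H.Q.map (H.P.map t)) (H.d_Qj Y)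
  have h3 := H.d_Qj Y
  have h4 := H.τ_naturality (H.j.app Y)
  simp only [Category.assoc, Functor.comp_obj, Functor.map_comp] at h1 h2 h3 h4 ⊢
  rw [reassoc_of% h1, h2, reassoc_of% h3, H.coassoc, reassoc_of% (H.d_Qj (H.D.obj Y)), ← h4,
    reassoc_of% h3]

theorem d_counit (Y : B) : H.d Y ≫ H.Q.map (H.εD Y) = 𝟙 _ := by
  apply ((H.isEqualizer_s Y).map H.Q).cancel
  have h1 := congrArg H.Q.map (H.εD_s Y)
  have h3 := H.d_Qj Y
  simp only [Category.assoc, Functor.comp_obj, Functor.id_obj, Functor.map_comp] at h1 h3 ⊢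
  rw [h1, reassoc_of% h3, H.τ_z]
  exact (Category.id_comp _).symm

theorem δD_naturality {X Y : B} (f : X ⟶ Y) :
    H.D.map f ≫ H.δD Y = H.δD X ≫ H.D.map (H.D.map f) := by
  apply (H.isEqualizer_j _).cancel
  have h1 := congrArg H.P.map (H.d_naturality f)
  simp only [Category.assoc, Functor.map_comp] at h1 ⊢
  rw [H.δD_j, reassoc_of% (H.j_naturality f), h1, H.j_naturality, reassoc_of% (H.δD_j X)]

theorem εD_naturality {X Y : B} (f : X ⟶ Y) : H.D.map f ≫ H.εD Y = H.εD X ≫ f := by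
  apply (H.isEqualizer_s _).cancel
  have h1 := H.εD_s X
  have h2 := H.εD_s Y
  simp only [Functor.comp_obj] at h1 h2
  simp only [Category.assoc, Functor.id_obj]
  rw [h2, reassoc_of% (H.j_naturality f), H.z_naturality, H.s_naturality, reassoc_of% h1]

/-- The comonad `(D, Δ, ε)` on `B`. -/
def comonadD : Comonad B where
  toFunctor := H.D
  ε := { app := H.εD, naturality := fun _ _ f => H.εD_naturality f }
  δ := { app := H.δD, naturality := fun _ _ f => H.δD_naturality f }
  coassoc Y := by
    apply (H.isEqualizer_j _).cancel
    have h1 := H.δD_j Y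
    have h2 := H.δD_j (H.D.obj Y)
    have h3 := H.j_naturality (H.δD Y)
    have h4 := congrArg H.P.map (H.d_coassoc Y)
    simp only [Category.assoc, Functor.comp_obj, Functor.map_comp] at h1 h2 h3 h4 ⊢
    rw [h3, h2, reassoc_of% h1, reassoc_of% h1, h4]
  left_counit Y := by
    apply (H.isEqualizer_s _).cancel
    have h1 := H.εD_s (H.D.obj Y)
    have h2 := H.δD_j Y
    have h3 := H.z_naturality (H.j.app Y)
    have h4 := congrArg H.P.map (H.d_Qj Y)
    have h5 := H.s_naturality (H.j.app Y)
    have h6 := (H.isEqualizer_j Y).map H.S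
    apply h6.cancel
    simp only [Category.assoc, Functor.comp_obj, Functor.id_obj, Functor.map_comp]
      at h1 h2 h3 h4 h5 ⊢
    rw [reassoc_of% h1, reassoc_of% h2, ← h3, reassoc_of% h4, H.j_condition, ← h5]
    simp
  right_counit Y := by
    apply (H.isEqualizer_j Y).cancel
    have h2 := H.δD_j Y
    have h3 := H.j_naturality (H.εD Y)
    have h4 := congrArg H.P.map (H.d_counit Y)
    simp only [Category.assoc, Functor.comp_obj, Functor.map_comp] at h2 h3 h4 ⊢
    rw [h3, reassoc_of% h2, h4]
    simp

end D

end Setting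

end Setting

section Definitions

variable {A : Type u₁} [Category.{v₁} A] {B : Type u₂} [Category.{v₂} B]
  {T : Type u₃} [Category.{v₃} T]

/-- A pre-torsor over two adjunctions `N_A ⊣ R_A` and `N_B ⊣ R_B`, where `N_A : A ⥤ T` and
`N_B : B ⥤ T`, is a natural transformation `τ : R_A N_B ⟶ R_A N_B R_B N_A R_A N_B` with
`(R_A N_B R_B ε^A N_B) ∘ τ = R_A N_B η^B`, `(R_A ε^B N_A R_A N_B) ∘ τ = η^A R_A N_B` and
`(R_A N_B R_B N_A τ) ∘ τ = (τ R_B N_A R_A N_B) ∘ τ`. -/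
structure PreTorsor {NA : A ⥤ T} {RA : T ⥤ A} {NB : B ⥤ T} {RB : T ⥤ B}
    (adjA : NA ⊣ RA) (adjB : NB ⊣ RB) where
  τ : NB ⋙ RA ⟶ NB ⋙ RA ⋙ NA ⋙ RB ⋙ NB ⋙ RA
  τ_counitA : ∀ Y : B,
    τ.app Y ≫ RA.map (NB.map (RB.map (adjA.counit.app (NB.obj Y)))) =
      RA.map (NB.map (adjB.unit.app Y))
  τ_counitB : ∀ Y : B,
    τ.app Y ≫ RA.map (adjB.counit.app (NA.obj (RA.obj (NB.obj Y)))) =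
      adjA.unit.app (RA.obj (NB.obj Y))
  coassoc : ∀ Y : B,
    τ.app Y ≫ RA.map (NB.map (RB.map (NA.map (τ.app Y)))) =
      τ.app Y ≫ τ.app (RB.obj (NA.obj (RA.obj (NB.obj Y))))

/-- A comonad arrow `(F, ξ)` from a comonad `C` on `A` to a comonad `C'` on `T`, with `F : T ⥤ A`
and `ξ : CF ⟶ FC'`. -/
structure ComonadArrow (C : Comonad A) (C' : Comonad T) (F : T ⥤ A) where
  ξ : F ⋙ C.toFunctor ⟶ C'.toFunctor ⋙ F
  counit : ∀ X : T, ξ.app X ≫ F.map (C'.ε.app X) = C.ε.app (F.obj X)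
  comul : ∀ X : T, ξ.app X ≫ F.map (C'.δ.app X) =
    C.δ.app (F.obj X) ≫ C.toFunctor.map (ξ.app X) ≫ ξ.app (C'.toFunctor.obj X)

namespace ComonadArrow

variable {C : Comonad A} {C' : Comonad T} {F : T ⥤ A}

/-- The comonad arrow `(F, ξ)` is regular if `ξ` is an isomorphism. -/
def IsRegular (a : ComonadArrow C C' F) : Prop := IsIso a.ξ

/-- For a left adjoint `G` of `F`, the mate `(ε C' G) ∘ (G ξ G) ∘ (G C η) : GC ⟶ C'G` of `ξ`. -/
def mate (a : ComonadArrow C C' F) {G : A ⥤ T} (adj : G ⊣ F) :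
    C.toFunctor ⋙ G ⟶ G ⋙ C'.toFunctor where
  app X := G.map (C.toFunctor.map (adj.unit.app X)) ≫ G.map (a.ξ.app (G.obj X)) ≫
    adj.counit.app (C'.toFunctor.obj (G.obj X))
  naturality X Y f := by
    have h1 := congrArg (fun t => G.map (C.toFunctor.map t)) (adj.unit.naturality f)
    have h2 := congrArg G.map (a.ξ.naturality (G.map f))
    have h3 := adj.counit.naturality (C'.toFunctor.map (G.map f))
    simp only [Functor.comp_obj, Functor.comp_map, Functor.map_comp, Functor.id_obj,
      Functor.id_map, Category.assoc] at h1 h2 h3 ⊢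
    rw [reassoc_of% h1, reassoc_of% h2, h3]

/-- The comonad arrow `(F, ξ)` is co-regular, with respect to a left adjoint `G` of `F`, if the
mate `GC ⟶ C'G` of `ξ` is an isomorphism. -/
def IsCoregular (a : ComonadArrow C C' F) {G : A ⥤ T} (adj : G ⊣ F) : Prop :=
  IsIso (a.mate adj)

end ComonadArrow

/-- The objects of `RArr_reg(A, B)` over two given adjunctions `N_A ⊣ R_A` and `N_B ⊣ R_B`: a
comonad `C` on `A` together with a regular comonad arrow `(R_A, ξ)` from `C` to the comonad
`N_B R_B` on `T`, such that both adjunctions are regular and `C` preserves equalizers. -/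
structure RegularObject {NA : A ⥤ T} {RA : T ⥤ A} {NB : B ⥤ T} {RB : T ⥤ B}
    (adjA : NA ⊣ RA) (adjB : NB ⊣ RB) where
  comonad : Comonad A
  arrow : ComonadArrow comonad adjB.toComonad RA
  regular : arrow.IsRegular
  regularA : IsRegularAdjunction adjA
  regularB : IsRegularAdjunction adjB
  preservesEqualizers : PreservesLimitsOfShape WalkingParallelPair comonad.toFunctor

/-- The co-regular analogue: a comonad `C` on `A` together with a co-regular comonad arrow
`(R_A, ξ)` from `C` to the comonad `N_B R_B` on `T`, such that both adjunctions are regular and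
`C` preserves equalizers. -/
structure CoregularObject {NA : A ⥤ T} {RA : T ⥤ A} {NB : B ⥤ T} {RB : T ⥤ B}
    (adjA : NA ⊣ RA) (adjB : NB ⊣ RB) where
  comonad : Comonad A
  arrow : ComonadArrow comonad adjB.toComonad RA
  coregular : arrow.IsCoregular adjA
  regularA : IsRegularAdjunction adjA
  regularB : IsRegularAdjunction adjB
  preservesEqualizers : PreservesLimitsOfShape WalkingParallelPair comonad.toFunctor

end Definitions

namespace PreTorsor

variable {A : Type u₁} [Category.{v₁} A] {B : Type u₂} [Category.{v₂} B]
  {T : Type u₃} [Category.{v₃} T]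
  {NA : A ⥤ T} {RA : T ⥤ A} {NB : B ⥤ T} {RB : T ⥤ B}
  {adjA : NA ⊣ RA} {adjB : NB ⊣ RB}

variable (X : PreTorsor adjA adjB)

theorem τ_naturality {Y Z : B} (f : Y ⟶ Z) :
    RA.map (NB.map f) ≫ X.τ.app Z =
      X.τ.app Y ≫ RA.map (NB.map (RB.map (NA.map (RA.map (NB.map f))))) :=
  X.τ.naturality f

variable [HasEqualizers A] [HasEqualizers B]

/-- The data `Q = R_A N_B`, `P = R_B N_A`, `R = R_A N_A`, `S = R_B N_B`, `r = η^A`, `s = η^B`,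
`w = R_A ε^B N_A`, `z = R_B ε^A N_B` and `τ` of a regular pre-torsor. -/
def setting (hA : IsRegularAdjunction adjA)
    (hB : IsRegularAdjunction adjB) : Setting A B :=
  have := hA.preservesEqualizers
  have := hB.preservesEqualizers
  have : PreservesLimitsOfShape WalkingParallelPair RA :=
    (adjA.rightAdjoint_preservesLimits).preservesLimitsOfShape
  have : PreservesLimitsOfShape WalkingParallelPair RB :=
    (adjB.rightAdjoint_preservesLimits).preservesLimitsOfShape
  { P := NA ⋙ RB
    Q := NB ⋙ RA
    R := NA ⋙ RA
    S := NB ⋙ RB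
    r := adjA.unit
    s := adjB.unit
    w :=
      { app := fun Y => RA.map (adjB.counit.app (NA.obj Y))
        naturality := fun _ _ f => by
          have h := congrArg RA.map (adjB.counit.naturality (NA.map f))
          simpa only [Functor.map_comp, Functor.comp_map, Functor.id_map] using h }
    z :=
      { app := fun Y => RB.map (adjA.counit.app (NB.obj Y))
        naturality := fun _ _ f => by
          have h := congrArg RB.map (adjA.counit.naturality (NB.map f))
          simpa only [Functor.map_comp, Functor.comp_map, Functor.id_map] using h }
    τ :=
      { app := fun Y => X.τ.app Y
        naturality := fun _ _ f => X.τ.naturality f }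
    preservesP := inferInstance
    preservesQ := inferInstance
    preservesR := inferInstance
    preservesS := inferInstance
    isEqualizer_r := fun Y => isEqualizer_unit adjA hA.unit_isRegularMono Y
    isEqualizer_s := fun Y => isEqualizer_unit adjB hB.unit_isRegularMono Y
    coassoc := fun Y => X.coassoc Y
    τ_z := fun Y => X.τ_counitA Y
    τ_w := fun Y => X.τ_counitB Y }

variable (hA : IsRegularAdjunction adjA) (hB : IsRegularAdjunction adjB)

/-- The comonad `C` on `A`, whose functor is the equalizer `i : C ⟶ R_A N_B R_B N_A` of
`ωˡ = (R_A N_B R_B N_A R_A ε^B N_A) ∘ (τ R_B N_A)` and `ωʳ = R_A N_B R_B N_A η^A`, with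
`(ii) ∘ Δ = (τ R_B N_A) ∘ i` and `η^A ∘ ε = (R_A ε^B N_A) ∘ i`. -/
def comonadC : Comonad A := (X.setting hA hB).comonadC

/-- The component of the canonical monomorphism `i : C ⟶ R_A N_B R_B N_A`. -/
def ιC (Y : A) : (X.comonadC hA hB).toFunctor.obj Y ⟶ RA.obj (NB.obj (RB.obj (NA.obj Y))) :=
  (X.setting hA hB).i.app Y

theorem isEqualizer_ιC (Y : A) :
    IsEqualizer (X.ιC hA hB Y)
      (X.τ.app (RB.obj (NA.obj Y)) ≫
        RA.map (NB.map (RB.map (NA.map (RA.map (adjB.counit.app (NA.obj Y)))))))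
      (RA.map (NB.map (RB.map (NA.map (adjA.unit.app Y))))) :=
  (X.setting hA hB).isEqualizer_i Y

theorem ιC_naturality {Y Z : A} (f : Y ⟶ Z) :
    (X.comonadC hA hB).toFunctor.map f ≫ X.ιC hA hB Z =
      X.ιC hA hB Y ≫ RA.map (NB.map (RB.map (NA.map f))) :=
  (X.setting hA hB).i_naturality f

theorem ιC_counit (Y : A) :
    (X.comonadC hA hB).ε.app Y ≫ adjA.unit.app Y =
      X.ιC hA hB Y ≫ RA.map (adjB.counit.app (NA.obj Y)) :=
  (X.setting hA hB).εC_r Y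

theorem ιC_comul (Y : A) :
    (X.comonadC hA hB).δ.app Y ≫ X.ιC hA hB ((X.comonadC hA hB).toFunctor.obj Y) ≫
        RA.map (NB.map (RB.map (NA.map (X.ιC hA hB Y)))) =
      X.ιC hA hB Y ≫ X.τ.app (RB.obj (NA.obj Y)) := by
  rw [← X.ιC_naturality hA hB]
  exact (X.setting hA hB).c_naturality_δ Y

/-- The component of `ξ`. -/
def ξApp (t : T) : (X.comonadC hA hB).toFunctor.obj (RA.obj t) ⟶ RA.obj (NB.obj (RB.obj t)) :=
  X.ιC hA hB (RA.obj t) ≫ RA.map (NB.map (RB.map (adjA.counit.app t)))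

theorem ξApp_naturality {s t : T} (f : s ⟶ t) :
    (X.comonadC hA hB).toFunctor.map (RA.map f) ≫ X.ξApp hA hB t =
      X.ξApp hA hB s ≫ RA.map (NB.map (RB.map f)) := by
  have h := congrArg (fun u => RA.map (NB.map (RB.map u))) (adjA.counit.naturality f)
  simp only [ξApp, Functor.comp_obj, Functor.comp_map, Functor.map_comp, Functor.id_obj,
    Functor.id_map, Category.assoc] at h ⊢
  rw [reassoc_of% (X.ιC_naturality hA hB (RA.map f)), h]

theorem ξApp_counit (t : T) :
    X.ξApp hA hB t ≫ RA.map (adjB.counit.app t) = (X.comonadC hA hB).ε.app (RA.obj t) := by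
  have h1 := congrArg RA.map (adjB.counit.naturality (adjA.counit.app t))
  have h2 := X.ιC_counit hA hB (RA.obj t)
  simp only [ξApp, Functor.comp_obj, Functor.comp_map, Functor.map_comp, Functor.id_obj,
    Functor.id_map, Category.assoc] at h1 h2 ⊢
  rw [h1, ← reassoc_of% h2, adjA.right_triangle_components]
  exact Category.comp_id _

theorem ξApp_comul (t : T) :
    X.ξApp hA hB t ≫ RA.map (NB.map (adjB.unit.app (RB.obj t))) =
      (X.comonadC hA hB).δ.app (RA.obj t) ≫ (X.comonadC hA hB).toFunctor.map (X.ξApp hA hB t) ≫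
        X.ξApp hA hB (NB.obj (RB.obj t)) := by
  have h1 := congrArg (fun u => RA.map (NB.map (RB.map u)))
    (adjA.counit.naturality (NB.map (RB.map (adjA.counit.app t))))
  have h2 := X.ιC_comul hA hB (RA.obj t)
  have h3 := congrArg (fun u => RA.map (NB.map u)) (adjB.unit.naturality
    (RB.map (adjA.counit.app t)))
  have h4 := X.τ_counitA (RB.obj (NA.obj (RA.obj t)))
  have h5 := X.ιC_naturality hA hB (X.ιC hA hB (RA.obj t))
  have h6 := X.ιC_naturality hA hB (RA.map (NB.map (RB.map (adjA.counit.app t))))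
  simp only [ξApp, Functor.comp_obj, Functor.comp_map, Functor.map_comp, Functor.id_obj,
    Functor.id_map, Category.assoc] at h1 h2 h3 h4 h5 h6 ⊢
  rw [reassoc_of% h6, reassoc_of% h5, reassoc_of% h2, h1, reassoc_of% h4, h3]

/-- `ξ = (R_A N_B R_B ε^A) ∘ (i R_A) : C R_A ⟶ R_A N_B R_B`. -/
def ξ : RA ⋙ (X.comonadC hA hB).toFunctor ⟶ adjB.toComonad.toFunctor ⋙ RA where
  app t := X.ξApp hA hB t
  naturality _ _ f := X.ξApp_naturality hA hB f

/-- `(R_A, ξ)` as a comonad arrow from `C` to `N_B R_B`. -/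
def arrowC : ComonadArrow (X.comonadC hA hB) adjB.toComonad RA where
  ξ := X.ξ hA hB
  counit t := X.ξApp_counit hA hB t
  comul t := X.ξApp_comul hA hB t

theorem ξApp_isIso (t : T) : IsIso (X.ξApp hA hB t) := by
  have h1 := X.coassoc (RB.obj t)
  have h2 := X.τ_counitB (RB.obj t)
  have h3 := X.τ_counitA (RB.obj t)
  have e := X.isEqualizer_ιC hA hB (RA.obj t)
  have h4 := e.condition
  have hk : (X.τ.app (RB.obj t) ≫
      RA.map (NB.map (RB.map (NA.map (RA.map (adjB.counit.app t)))))) ≫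
        (X.τ.app (RB.obj (NA.obj (RA.obj t))) ≫ RA.map (NB.map (RB.map (NA.map
          (RA.map (adjB.counit.app (NA.obj (RA.obj t))))))))  =
      (X.τ.app (RB.obj t) ≫ RA.map (NB.map (RB.map (NA.map (RA.map (adjB.counit.app t)))))) ≫
        RA.map (NB.map (RB.map (NA.map (adjA.unit.app (RA.obj t))))) := by
    have h5 := X.τ_naturality (RB.map (NA.map (RA.map (adjB.counit.app t))))
    have h6 := congrArg (fun u => RA.map (NB.map (RB.map (NA.map (RA.map u)))))
      (adjB.counit.naturality (NA.map (RA.map (adjB.counit.app t))))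
    have h7 := congrArg (fun u => RA.map (NB.map (RB.map (NA.map u)))) h2
    have h8 := congrArg (fun u => RA.map (NB.map (RB.map (NA.map u))))
      (adjA.unit.naturality (RA.map (adjB.counit.app t)))
    simp only [Functor.comp_obj, Functor.comp_map, Functor.map_comp, Functor.id_obj,
      Functor.id_map, Category.assoc] at h1 h2 h5 h6 h7 h8 ⊢
    rw [reassoc_of% h5, ← reassoc_of% h1, h6, reassoc_of% h7, h8]
  refine ⟨e.lift _ hk, ?_, ?_⟩
  · apply e.cancel
    have h5 := X.τ_naturality (RB.map (adjA.counit.app t))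
    have h6 := congrArg (fun u => RA.map (NB.map (RB.map (NA.map (RA.map u)))))
      (adjB.counit.naturality (adjA.counit.app t))
    have h7 := congrArg (fun u => RA.map (NB.map (RB.map (NA.map u))))
      (adjA.right_triangle_components t)
    rw [Category.assoc, e.lift_comp]
    simp only [ξApp, Functor.comp_obj, Functor.comp_map, Functor.map_comp, Functor.id_obj,
      Functor.id_map, Category.assoc] at h4 h5 h6 h7 ⊢
    rw [reassoc_of% h5, h6, reassoc_of% h4, h7]
    simp
  · have h5 := e.lift_comp _ hk
    have h6 := congrArg (fun u => RA.map (NB.map (RB.map u)))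
      (adjA.counit.naturality (adjB.counit.app t))
    have h7 := congrArg (fun u => RA.map (NB.map u)) (adjB.right_triangle_components t)
    simp only [ξApp, Functor.comp_obj, Functor.comp_map, Functor.map_comp, Functor.id_obj,
      Functor.id_map] at h3 h5 h6 h7 ⊢
    rw [reassoc_of% h5, h6, reassoc_of% h3, h7]
    simp

theorem ξ_isIso : IsIso (X.ξ hA hB) := by
  have : ∀ t : T, IsIso ((X.ξ hA hB).app t) := fun t => X.ξApp_isIso hA hB t
  exact NatIso.isIso_of_isIso_app _

/-- The object `(C, ξ)` of `RArr_reg(A, B)` associated to a regular pre-torsor. -/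
def toRegularObject : RegularObject adjA adjB where
  comonad := X.comonadC hA hB
  arrow := X.arrowC hA hB
  regular := X.ξ_isIso hA hB
  regularA := hA
  regularB := hB
  preservesEqualizers := (X.setting hA hB).preservesC

/-- The comonad `D` on `B`, whose functor is the equalizer `j : D ⟶ R_B N_A R_A N_B` of
`θˡ = (R_B ε^A N_B R_B N_A R_A N_B) ∘ (R_B N_A τ)` and `θʳ = η^B R_B N_A R_A N_B`, with
`(jj) ∘ Δ = (R_B N_A τ) ∘ j` and `η^B ∘ ε = (R_B ε^A N_B) ∘ j`. -/
def comonadD : Comonad B := (X.setting hA hB).comonadD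

/-- The component of the canonical monomorphism `j : D ⟶ R_B N_A R_A N_B`. -/
def ιD (Y : B) : (X.comonadD hA hB).toFunctor.obj Y ⟶ RB.obj (NA.obj (RA.obj (NB.obj Y))) :=
  (X.setting hA hB).j.app Y

theorem isEqualizer_ιD (Y : B) :
    IsEqualizer (X.ιD hA hB Y)
      (RB.map (NA.map (X.τ.app Y)) ≫
        RB.map (adjA.counit.app (NB.obj (RB.obj (NA.obj (RA.obj (NB.obj Y)))))))
      (adjB.unit.app (RB.obj (NA.obj (RA.obj (NB.obj Y))))) :=
  (X.setting hA hB).isEqualizer_j Y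

theorem ιD_naturality {Y Z : B} (f : Y ⟶ Z) :
    (X.comonadD hA hB).toFunctor.map f ≫ X.ιD hA hB Z =
      X.ιD hA hB Y ≫ RB.map (NA.map (RA.map (NB.map f))) :=
  (X.setting hA hB).j_naturality f

theorem ιD_counit (Y : B) :
    (X.comonadD hA hB).ε.app Y ≫ adjB.unit.app Y =
      X.ιD hA hB Y ≫ RB.map (adjA.counit.app (NB.obj Y)) :=
  (X.setting hA hB).εD_s Y

theorem ιD_comul (Y : B) :
    (X.comonadD hA hB).δ.app Y ≫ X.ιD hA hB ((X.comonadD hA hB).toFunctor.obj Y) ≫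
        RB.map (NA.map (RA.map (NB.map (X.ιD hA hB Y)))) =
      X.ιD hA hB Y ≫ RB.map (NA.map (X.τ.app Y)) := by
  have h1 := (X.setting hA hB).δD_j Y
  have h2 := congrArg (X.setting hA hB).P.map ((X.setting hA hB).d_Qj Y)
  have h3 : ((X.setting hA hB).δD Y ≫ (X.setting hA hB).j.app _) ≫
      (X.setting hA hB).P.map ((X.setting hA hB).Q.map ((X.setting hA hB).j.app Y)) =
      (X.setting hA hB).j.app Y ≫ (X.setting hA hB).P.map ((X.setting hA hB).τ.app Y) := by
    rw [h1, Category.assoc, ← h2, Functor.map_comp]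
  exact (Category.assoc _ _ _).symm.trans h3

/-- The component of `ζ`. -/
def ζApp (t : T) : (X.comonadD hA hB).toFunctor.obj (RB.obj t) ⟶ RB.obj (NA.obj (RA.obj t)) :=
  X.ιD hA hB (RB.obj t) ≫ RB.map (NA.map (RA.map (adjB.counit.app t)))

theorem ζApp_naturality {s t : T} (f : s ⟶ t) :
    (X.comonadD hA hB).toFunctor.map (RB.map f) ≫ X.ζApp hA hB t =
      X.ζApp hA hB s ≫ RB.map (NA.map (RA.map f)) := by
  have h := congrArg (fun u => RB.map (NA.map (RA.map u))) (adjB.counit.naturality f)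
  simp only [ζApp, Functor.comp_obj, Functor.comp_map, Functor.map_comp, Functor.id_obj,
    Functor.id_map, Category.assoc] at h ⊢
  rw [reassoc_of% (X.ιD_naturality hA hB (RB.map f)), h]

theorem ζApp_counit (t : T) :
    X.ζApp hA hB t ≫ RB.map (adjA.counit.app t) = (X.comonadD hA hB).ε.app (RB.obj t) := by
  have h1 := congrArg RB.map (adjA.counit.naturality (adjB.counit.app t))
  have h2 := X.ιD_counit hA hB (RB.obj t)
  simp only [ζApp, Functor.comp_obj, Functor.comp_map, Functor.map_comp, Functor.id_obj,
    Functor.id_map, Category.assoc] at h1 h2 ⊢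
  rw [h1, ← reassoc_of% h2, adjB.right_triangle_components]
  exact Category.comp_id _

theorem ζApp_comul (t : T) :
    X.ζApp hA hB t ≫ RB.map (NA.map (adjA.unit.app (RA.obj t))) =
      (X.comonadD hA hB).δ.app (RB.obj t) ≫ (X.comonadD hA hB).toFunctor.map (X.ζApp hA hB t) ≫
        X.ζApp hA hB (NA.obj (RA.obj t)) := by
  have h1 := congrArg (fun u => RB.map (NA.map (RA.map u)))
    (adjB.counit.naturality (NA.map (RA.map (adjB.counit.app t))))
  have h2 := X.ιD_comul hA hB (RB.obj t)
  have h3 := congrArg (fun u => RB.map (NA.map u)) (adjA.unit.naturality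
    (RA.map (adjB.counit.app t)))
  have h4 := congrArg (fun u => RB.map (NA.map u)) (X.τ_counitB (RB.obj t))
  have h5 := X.ιD_naturality hA hB (X.ιD hA hB (RB.obj t))
  have h6 := X.ιD_naturality hA hB (RB.map (NA.map (RA.map (adjB.counit.app t))))
  simp only [ζApp, Functor.comp_obj, Functor.comp_map, Functor.map_comp, Functor.id_obj,
    Functor.id_map, Category.assoc] at h1 h2 h3 h4 h5 h6 ⊢
  rw [reassoc_of% h6, reassoc_of% h5, reassoc_of% h2, h1, reassoc_of% h4, h3]

/-- `ζ = (R_B N_A R_A ε^B) ∘ (j R_B) : D R_B ⟶ R_B N_A R_A`. -/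
def ζ : RB ⋙ (X.comonadD hA hB).toFunctor ⟶ adjA.toComonad.toFunctor ⋙ RB where
  app t := X.ζApp hA hB t
  naturality _ _ f := X.ζApp_naturality hA hB f

/-- `(R_B, ζ)` as a comonad arrow from `D` to `N_A R_A`. -/
def arrowD : ComonadArrow (X.comonadD hA hB) adjA.toComonad RB where
  ξ := X.ζ hA hB
  counit t := X.ζApp_counit hA hB t
  comul t := X.ζApp_comul hA hB t

theorem mate_arrowD_app (Y : B) :
    ((X.arrowD hA hB).mate adjB).app Y =
      NB.map (X.ιD hA hB Y) ≫ adjB.counit.app (NA.obj (RA.obj (NB.obj Y))) := by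
  change NB.map ((X.comonadD hA hB).toFunctor.map (adjB.unit.app Y)) ≫
    NB.map (X.ζApp hA hB (NB.obj Y)) ≫ adjB.counit.app (NA.obj (RA.obj (NB.obj Y))) = _
  have h1 := congrArg NB.map (X.ιD_naturality hA hB (adjB.unit.app Y))
  have h2 := congrArg (fun u => NB.map (RB.map (NA.map (RA.map u))))
    (adjB.left_triangle_components Y)
  simp only [ζApp, Functor.comp_obj, Functor.map_comp, Functor.id_obj,
    Category.assoc] at h1 h2 ⊢
  rw [reassoc_of% h1, reassoc_of% h2]
  simp

theorem arrowD_isIso_app (Y : B) :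
    IsIso (NB.map (X.ιD hA hB Y) ≫ adjB.counit.app (NA.obj (RA.obj (NB.obj Y)))) := by
  have := hB.preservesEqualizers
  have e := (X.isEqualizer_ιD hA hB Y).map NB
  have h0 := congrArg NB.map (X.isEqualizer_ιD hA hB Y).condition
  have h1 := congrArg NA.map (X.coassoc Y)
  have h2 := congrArg NA.map (X.τ_counitB Y)
  have h3 := congrArg NA.map (X.τ_counitA (RB.obj (NA.obj (RA.obj (NB.obj Y)))))
  have hk : (NA.map (X.τ.app Y) ≫
      adjA.counit.app (NB.obj (RB.obj (NA.obj (RA.obj (NB.obj Y)))))) ≫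
      NB.map (RB.map (NA.map (X.τ.app Y)) ≫
        RB.map (adjA.counit.app (NB.obj (RB.obj (NA.obj (RA.obj (NB.obj Y))))))) =
      (NA.map (X.τ.app Y) ≫
      adjA.counit.app (NB.obj (RB.obj (NA.obj (RA.obj (NB.obj Y)))))) ≫
      NB.map (adjB.unit.app (RB.obj (NA.obj (RA.obj (NB.obj Y))))) := by
    have h4 := adjA.counit.naturality (NB.map (RB.map (NA.map (X.τ.app Y))))
    have h5 := adjA.counit.naturality (NB.map (RB.map (adjA.counit.app
      (NB.obj (RB.obj (NA.obj (RA.obj (NB.obj Y))))))))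
    have h6 := adjA.counit.naturality
      (NB.map (adjB.unit.app (RB.obj (NA.obj (RA.obj (NB.obj Y))))))
    simp only [Functor.comp_obj, Functor.comp_map, Functor.map_comp, Functor.id_obj,
      Functor.id_map, Category.assoc] at h1 h3 h4 h5 h6 ⊢
    rw [← reassoc_of% h4, reassoc_of% h1, ← h5, reassoc_of% h3, h6]
  have hl := e.lift_comp _ hk
  refine ⟨e.lift _ hk, ?_, ?_⟩
  · apply e.cancel
    have h4 := adjB.counit.naturality (NA.map (X.τ.app Y))
    have h5 := adjB.counit.naturality
      (adjA.counit.app (NB.obj (RB.obj (NA.obj (RA.obj (NB.obj Y))))))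
    have h6 := adjB.left_triangle_components (RB.obj (NA.obj (RA.obj (NB.obj Y))))
    simp only [Functor.comp_obj, Functor.comp_map, Functor.map_comp, Functor.id_obj,
      Functor.id_map, Category.assoc] at h0 h4 h5 h6 hl ⊢
    rw [hl, ← reassoc_of% h4, ← h5, reassoc_of% h0, h6]
    exact (Category.comp_id _).trans (Category.id_comp _).symm
  · have h5 := adjA.counit.naturality (adjB.counit.app (NA.obj (RA.obj (NB.obj Y))))
    have h6 := adjA.left_triangle_components (RA.obj (NB.obj Y))
    simp only [Functor.comp_obj, Functor.comp_map, Functor.map_comp, Functor.id_obj,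
      Functor.id_map] at h2 h5 h6 hl ⊢
    rw [reassoc_of% hl, ← h5, reassoc_of% h2, h6]

theorem arrowD_isCoregular : (X.arrowD hA hB).IsCoregular adjB := by
  have : ∀ Y : B, IsIso (((X.arrowD hA hB).mate adjB).app Y) := fun Y => by
    rw [X.mate_arrowD_app hA hB Y]
    exact X.arrowD_isIso_app hA hB Y
  exact NatIso.isIso_of_isIso_app _

/-- The co-regular object `(D, ζ)`, over the adjunctions `N_B ⊣ R_B` and `N_A ⊣ R_A` in this
order, associated to a regular pre-torsor. -/
def toCoregularObject : CoregularObject adjB adjA where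
  comonad := X.comonadD hA hB
  arrow := X.arrowD hA hB
  coregular := X.arrowD_isCoregular hA hB
  regularA := hB
  regularB := hA
  preservesEqualizers := (X.setting hA hB).preservesD

end PreTorsor

end PreTorsors

end

namespace PreTorsors

/-! ### Contexts: an intermediate category between the two kinds of comodules -/

namespace Setting

variable {A : Type u₁} [Category.{v₁} A] {B : Type u₂} [Category.{v₂} B]

/-! Put `Q = R_A N_B` and `P = R_B N_A`. Composing a `C`-coaction with `i` gives `κ : X ⟶ QPX`, and
composing a `D`-coaction with `j` gives `κ' : Y ⟶ PQY`. The equivalence should match `X` and `Y`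
when there are `u : X ⟶ QY` and `v : Y ⟶ PX` with `κ = (Q v) ∘ u` and `κ' = (P u) ∘ v`. Rather than
building two functors between the comodule categories and comparing their composites with
identities, the proof takes such quadruples `(X, Y, u, v)`, the contexts, as objects of a third
category. It shows that forgetting to either kind of comodule is an equivalence.

Each half of a context determines the other. By naturality of `z`, the map `v` is the equalizer of
`s` and `z ∘ P κ` (`isEqualizer_v`), which involve only `κ`; likewise `u` is the equalizer of `τ`
and `Q κ'` (`isEqualizer_u`). Hence morphisms extend uniquely from one half to the whole context, so
both functors are full and faithful. Conversely, forming these equalizers from a given comodule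
produces the missing half (`exists_of_leftComodule`, `exists_of_rightComodule`), so both are
essentially surjective.

Regularity enters twice: the units are equalizers, so a map into `RX` or `SY` can be descended to
`X` or `Y`; and `P`, `Q`, `R`, `S` preserve equalizers, so identities may be tested after the images
of `u`, `v`, `i` and `j`. The definition is not symmetric in `u` and `v`: `τ` acts on `Q` alone, and
no companion map `P ⟶ PQP` is needed. -/

/-- A Morita-type context over the setting `H`: objects `X` of `A` and `Y` of `B` with morphisms
`u : X ⟶ Q Y` and `v : Y ⟶ P X` that are compatible with `w`, `z` and `τ`. -/
structure Context (H : Setting A B) where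
  left : A
  right : B
  u : left ⟶ H.Q.obj right
  v : right ⟶ H.P.obj left
  u_v_w : u ≫ H.Q.map v ≫ H.w.app left = H.r.app left
  v_u_z : v ≫ H.P.map u ≫ H.z.app right = H.s.app right
  u_τ : u ≫ H.τ.app right = u ≫ H.Q.map v ≫ H.Q.map (H.P.map u)

namespace Context

variable {H : Setting A B}

/-- A morphism of contexts is a pair of morphisms that commute with `u` and `v`. -/
@[ext]
structure Hom (E F : H.Context) where
  left : E.left ⟶ F.left
  right : E.right ⟶ F.right
  u : left ≫ F.u = E.u ≫ H.Q.map right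
  v : right ≫ F.v = E.v ≫ H.P.map left

instance : Category H.Context where
  Hom := Hom
  id E := { left := 𝟙 _, right := 𝟙 _, u := by simp, v := by simp }
  comp f g :=
    { left := f.left ≫ g.left
      right := f.right ≫ g.right
      u := by rw [Category.assoc, g.u, reassoc_of% f.u, H.Q.map_comp]
      v := by rw [Category.assoc, g.v, reassoc_of% f.v, H.P.map_comp] }
  id_comp _ := Hom.ext (Category.id_comp _) (Category.id_comp _)
  comp_id _ := Hom.ext (Category.comp_id _) (Category.comp_id _)
  assoc _ _ _ := Hom.ext (Category.assoc _ _ _) (Category.assoc _ _ _)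

theorem hom_ext {E F : H.Context} {f g : E ⟶ F} (h₁ : Hom.left f = Hom.left g)
    (h₂ : Hom.right f = Hom.right g) : f = g :=
  Hom.ext h₁ h₂

/-! ### Each structure map of a context is an equalizer -/

/-- The map `z ∘ P u : PX ⟶ SY` is a retraction of `v` up to the unit `s`. A test map `k` composed
with it equalizes the pair whose equalizer is `s`, hence descends to `Y`. By naturality of `z` the
second arrow of the pair is `z ∘ P κ` with `κ = (Q v) ∘ u`, so the pair depends only on the left
comodule. -/
theorem isEqualizer_v (E : H.Context) :
    IsEqualizer E.v (H.s.app (H.P.obj E.left))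
      (H.P.map E.u ≫ H.z.app E.right ≫ H.S.map E.v) := by
  have hs := fun Y => (H.isEqualizer_s Y).mono
  have hvz := E.v_u_z
  have hv := H.s_naturality E.v
  have hlift : ∀ {Z : B} (k : Z ⟶ H.P.obj E.left),
      k ≫ H.s.app (H.P.obj E.left) = k ≫ H.P.map E.u ≫ H.z.app E.right ≫ H.S.map E.v →
      ∃ l : Z ⟶ E.right, l ≫ E.v = k := by
    intro Z k hk
    have h1 := H.s_naturality (H.P.map E.u ≫ H.z.app E.right)
    have h2 := congrArg H.S.map E.v_u_z
    -- Expanding `S s` as `S` of `z ∘ (P u) ∘ v` makes the hypothesis on `k` applicable.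
    have e : (k ≫ H.P.map E.u ≫ H.z.app E.right) ≫ H.s.app (H.S.obj E.right) =
        (k ≫ H.P.map E.u ≫ H.z.app E.right) ≫ H.S.map (H.s.app E.right) := by
      simp only [Category.assoc, Functor.map_comp, Functor.id_obj] at h1 h2 hk ⊢
      rw [← h2, h1, reassoc_of% hk]
    have hl := (H.isEqualizer_s E.right).lift_comp _ e
    refine ⟨(H.isEqualizer_s E.right).lift _ e, (H.isEqualizer_s _).cancel ?_⟩
    simp only [Category.assoc, Functor.id_obj] at hl hv hk ⊢
    rw [hv, reassoc_of% hl, hk]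
  have : Mono E.v := by
    refine ⟨fun a b hab => (H.isEqualizer_s _).cancel ?_⟩
    rw [← E.v_u_z, reassoc_of% hab]
  refine IsEqualizer.of_lift ?_ hlift
  simp only [Functor.id_obj] at hvz hv ⊢
  rw [hv, reassoc_of% hvz]

/-- Here `w ∘ Q v : QY ⟶ RX` is a retraction of `u` up to the unit `r`. The pair depends only on the
right comodule, since its second arrow is `Q` applied to `(P u) ∘ v`. The law `w ∘ τ = r` plays the
part that naturality of `s` alone plays for `v`. -/
theorem isEqualizer_u (E : H.Context) :
    IsEqualizer E.u (H.τ.app E.right) (H.Q.map E.v ≫ H.Q.map (H.P.map E.u)) := by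
  have hlift : ∀ {Z : A} (k : Z ⟶ H.Q.obj E.right),
      k ≫ H.τ.app E.right = k ≫ H.Q.map E.v ≫ H.Q.map (H.P.map E.u) →
      ∃ l : Z ⟶ E.left, l ≫ E.u = k := by
    intro Z k hk
    have h1 := H.w_naturality E.u
    have h2 := congrArg H.R.map E.u_v_w
    have h3 := H.τ_w E.right
    have h4 := H.r_naturality (H.Q.map E.v ≫ H.w.app E.left)
    have h5 := H.r_naturality E.u
    have e : (k ≫ H.Q.map E.v ≫ H.w.app E.left) ≫ H.r.app (H.R.obj E.left) =
        (k ≫ H.Q.map E.v ≫ H.w.app E.left) ≫ H.R.map (H.r.app E.left) := by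
      simp only [Category.assoc, Functor.map_comp, Functor.comp_obj, Functor.id_obj]
        at h1 h2 h3 h4 hk ⊢
      rw [← h2, ← reassoc_of% h1, ← reassoc_of% hk, reassoc_of% h3, h4]
    have hl := (H.isEqualizer_r E.left).lift_comp _ e
    refine ⟨(H.isEqualizer_r E.left).lift _ e, (H.isEqualizer_r _).cancel ?_⟩
    simp only [Category.assoc, Functor.id_obj, Functor.comp_obj] at h1 h3 h5 hl hk ⊢
    rw [h5, reassoc_of% hl, ← h1, ← reassoc_of% hk, h3]
  have : Mono E.u := by
    refine ⟨fun a b hab => (H.isEqualizer_r _).cancel ?_⟩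
    rw [← E.u_v_w, reassoc_of% hab]
  exact IsEqualizer.of_lift E.u_τ hlift

/-! ### Contexts and `C`-comodules -/

section C

variable [HasEqualizers A]

/-- The `C`-coaction on the left object of a context, determined by `i ∘ σ = (Q v) ∘ u`. -/
noncomputable def σ (E : H.Context) : E.left ⟶ H.C.obj E.left :=
  (H.isEqualizer_i E.left).lift (E.u ≫ H.Q.map E.v) (by
    have h1 := H.τ_naturality E.v
    have h2 := congrArg (fun t => H.Q.map (H.P.map t)) E.u_v_w
    have h3 := E.u_τ
    simp only [ωl_app, ωr_app, Category.assoc, Functor.map_comp, Functor.comp_obj]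
      at h1 h2 h3 ⊢
    rw [reassoc_of% h1, reassoc_of% h3, h2])

theorem σ_i (E : H.Context) : E.σ ≫ H.i.app E.left = E.u ≫ H.Q.map E.v :=
  (H.isEqualizer_i E.left).lift_comp _ _

theorem σ_naturality {E F : H.Context} (f : E ⟶ F) :
    E.σ ≫ H.C.map f.left = f.left ≫ F.σ := by
  apply (H.isEqualizer_i _).cancel
  have h1 := E.σ_i
  have h2 := F.σ_i
  have h3 := H.i_naturality f.left
  have h4 := f.u
  have h5 := congrArg H.Q.map f.v
  simp only [Category.assoc, Functor.map_comp, Functor.comp_obj] at h1 h2 h3 h4 h5 ⊢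
  rw [h3, reassoc_of% h1, h2, reassoc_of% h4, h5]

/-- The left object of a context as a `C`-comodule. -/
noncomputable def leftComodule (E : H.Context) : H.comonadC.Coalgebra where
  A := E.left
  a := E.σ
  counit := by
    apply (H.isEqualizer_r _).cancel
    have h1 := E.σ_i
    have h2 := H.εC_r E.left
    have h3 := E.u_v_w
    change (E.σ ≫ H.εC _) ≫ _ = 𝟙 E.left ≫ _
    simp only [Category.assoc, Functor.comp_obj] at h1 h2 h3 ⊢
    rw [h2, reassoc_of% h1, h3]
    simp
  coassoc := by
    apply (H.isEqualizer_Ci _).cancel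
    apply (H.isEqualizer_i _).cancel
    -- After `i` and `C i` are cancelled, coassociativity is the law `u_τ` followed by `QPQ v`.
    have h1 := E.σ_i
    have h2 := H.c_naturality_δ E.left
    have h3 := H.i_naturality E.σ
    have h4 := H.i_naturality (H.i.app E.left)
    have h5 := H.τ_naturality E.v
    have h6 := E.u_τ
    have h7 := congrArg (fun t => H.Q.map (H.P.map t)) h1
    change ((E.σ ≫ H.δC _) ≫ _) ≫ _ = ((E.σ ≫ H.C.map E.σ) ≫ _) ≫ _
    simp only [Category.assoc, Functor.map_comp, Functor.comp_obj] at h1 h2 h3 h4 h5 h6 h7 ⊢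
    rw [h2, reassoc_of% h1, h5, reassoc_of% h6, h4, reassoc_of% h3, reassoc_of% h1, h7]

variable (H) in
/-- The functor from contexts to `C`-comodules. -/
noncomputable def toLeft : H.Context ⥤ H.comonadC.Coalgebra where
  obj E := E.leftComodule
  map f := { f := f.left, h := σ_naturality f }

/-- The right component is forced by the left one because `v` is a monomorphism. -/
instance : (toLeft H).Faithful where
  map_injective {E F f g} hfg := by
    have h : f.left = g.left := congrArg Comonad.Coalgebra.Hom.f hfg
    refine hom_ext h (F.isEqualizer_v.cancel ?_)
    rw [f.v, g.v, h]

instance : (toLeft H).Full where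
  map_surjective {E F} φ := by
    obtain ⟨f, hf⟩ := φ
    change E.left ⟶ F.left at f
    replace hf : E.σ ≫ H.C.map f = f ≫ F.σ := hf
    -- Composing with `i` replaces the coactions by the maps `κ`.
    replace hf : f ≫ F.u ≫ H.Q.map F.v = E.u ≫ H.Q.map E.v ≫ H.Q.map (H.P.map f) := by
      have h1 := E.σ_i
      have h2 := F.σ_i
      have h3 := H.i_naturality f
      rw [← h2, ← reassoc_of% hf, h3, reassoc_of% h1]
    -- This lets `P f` restrict along the equalizers `v`, which yields the right component.
    have e : (E.v ≫ H.P.map f) ≫ H.s.app (H.P.obj F.left) =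
        (E.v ≫ H.P.map f) ≫ H.P.map F.u ≫ H.z.app F.right ≫ H.S.map F.v := by
      have h1 := H.z_naturality F.v
      have h2 := H.z_naturality E.v
      have h3 := congrArg H.P.map hf
      have h4 := H.z_naturality (H.P.map f)
      have h5 := E.v_u_z
      have h6 := H.s_naturality (E.v ≫ H.P.map f)
      simp only [Category.assoc, Functor.map_comp, Functor.comp_obj, Functor.id_obj]
        at h1 h2 h3 h4 h5 h6 ⊢
      rw [← h1, reassoc_of% h3, h4, reassoc_of% h2, reassoc_of% h5, h6]
    have hg := F.isEqualizer_v.lift_comp _ e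
    refine ⟨⟨f, F.isEqualizer_v.lift _ e, ?_, hg⟩, rfl⟩
    -- Compatibility with `u` is tested after the monomorphism `Q v`, where it becomes `hf`.
    apply (F.isEqualizer_v.map H.Q).cancel
    rw [Category.assoc, Category.assoc, hf, ← H.Q.map_comp, ← H.Q.map_comp, hg]

end C

/-! ### Contexts and `D`-comodules -/

section D

variable [HasEqualizers B]

/-- The `D`-coaction on the right object of a context, determined by `j ∘ ρ = (P u) ∘ v`. -/
noncomputable def ρ (E : H.Context) : E.right ⟶ H.D.obj E.right :=
  (H.isEqualizer_j E.right).lift (E.v ≫ H.P.map E.u) (by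
    have h1 := H.z_naturality E.v
    have h2 := H.z_naturality (H.P.map E.u)
    have h3 := congrArg H.P.map E.u_τ
    have h4 := H.s_naturality (E.v ≫ H.P.map E.u)
    have h5 := E.v_u_z
    simp only [θl_app, θr_app, Category.assoc, Functor.map_comp, Functor.comp_obj,
      Functor.id_obj] at h1 h2 h3 h4 h5 ⊢
    rw [reassoc_of% h3, h2, reassoc_of% h1, reassoc_of% h5, h4])

theorem ρ_j (E : H.Context) : E.ρ ≫ H.j.app E.right = E.v ≫ H.P.map E.u :=
  (H.isEqualizer_j E.right).lift_comp _ _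

theorem ρ_naturality {E F : H.Context} (f : E ⟶ F) :
    E.ρ ≫ H.D.map f.right = f.right ≫ F.ρ := by
  apply (H.isEqualizer_j _).cancel
  have h1 := E.ρ_j
  have h2 := F.ρ_j
  have h3 := H.j_naturality f.right
  have h4 := f.v
  have h5 := congrArg H.P.map f.u
  simp only [Category.assoc, Functor.map_comp, Functor.comp_obj] at h1 h2 h3 h4 h5 ⊢
  rw [h3, reassoc_of% h1, h2, reassoc_of% h4, h5]

/-- The right object of a context as a `D`-comodule. -/
noncomputable def rightComodule (E : H.Context) : H.comonadD.Coalgebra where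
  A := E.right
  a := E.ρ
  counit := by
    apply (H.isEqualizer_s _).cancel
    have h1 := E.ρ_j
    have h2 := H.εD_s E.right
    have h3 := E.v_u_z
    change (E.ρ ≫ H.εD _) ≫ _ = 𝟙 E.right ≫ _
    simp only [Category.assoc, Functor.comp_obj] at h1 h2 h3 ⊢
    rw [h2, reassoc_of% h1, h3]
    simp
  coassoc := by
    apply (H.isEqualizer_j _).cancel
    -- Composing with `PQ j` turns `P d` into `P τ`, to which `u_τ` applies.
    apply ((H.isEqualizer_Qj _).map H.P).cancel
    have h1 := E.ρ_j
    have h2 := H.δD_j E.right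
    have h3 := H.j_naturality E.ρ
    have h4 := congrArg H.P.map (H.d_Qj E.right)
    have h5 := congrArg H.P.map E.u_τ
    have h6 := congrArg (fun t => H.P.map (H.Q.map t)) h1
    change ((E.ρ ≫ H.δD _) ≫ H.j.app (H.D.obj E.right)) ≫ _ =
      ((E.ρ ≫ H.D.map E.ρ) ≫ H.j.app (H.D.obj E.right)) ≫ _
    simp only [Category.assoc, Functor.map_comp, Functor.comp_obj] at h1 h2 h3 h4 h5 h6 ⊢
    rw [reassoc_of% h2, reassoc_of% h1, h4, h5, reassoc_of% h3, reassoc_of% h1, h6]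

variable (H) in
/-- The functor from contexts to `D`-comodules. -/
noncomputable def toRight : H.Context ⥤ H.comonadD.Coalgebra where
  obj E := E.rightComodule
  map f := { f := f.right, h := ρ_naturality f }

/-- The left component is forced by the right one because `u` is a monomorphism. -/
instance : (toRight H).Faithful where
  map_injective {E F f g} hfg := by
    have h : f.right = g.right := congrArg Comonad.Coalgebra.Hom.f hfg
    refine hom_ext (F.isEqualizer_u.cancel ?_) h
    rw [f.u, g.u, h]

instance : (toRight H).Full where
  map_surjective {E F} φ := by
    obtain ⟨g, hg⟩ := φ
    change E.right ⟶ F.right at g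
    replace hg : E.ρ ≫ H.D.map g = g ≫ F.ρ := hg
    replace hg : g ≫ F.v ≫ H.P.map F.u = E.v ≫ H.P.map E.u ≫ H.P.map (H.Q.map g) := by
      have h1 := E.ρ_j
      have h2 := F.ρ_j
      have h3 := H.j_naturality g
      rw [← h2, ← reassoc_of% hg, h3, reassoc_of% h1]
    -- This lets `Q g` restrict along the equalizers `u`, which yields the left component.
    have e : (E.u ≫ H.Q.map g) ≫ H.τ.app F.right =
        (E.u ≫ H.Q.map g) ≫ H.Q.map F.v ≫ H.Q.map (H.P.map F.u) := by
      have h1 := H.τ_naturality g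
      have h2 := congrArg H.Q.map hg
      have h3 := E.u_τ
      simp only [Category.assoc, Functor.map_comp, Functor.comp_obj] at h1 h2 h3 ⊢
      rw [h1, reassoc_of% h3, h2]
    have hf := F.isEqualizer_u.lift_comp _ e
    refine ⟨⟨F.isEqualizer_u.lift _ e, g, hf, ?_⟩, rfl⟩
    -- Compatibility with `v` is tested after the monomorphism `P u`, where it becomes `hg`.
    apply (F.isEqualizer_u.map H.P).cancel
    rw [Category.assoc, Category.assoc, hg, ← H.P.map_comp, ← H.P.map_comp, hf]

end D

/-! ### Completing a comodule to a context -/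

section EssSurj

variable [HasEqualizers A] [HasEqualizers B]

/-- By `isEqualizer_v` there is only one candidate for `v`: the equalizer of `s` and `z ∘ P κ`.
Since `Q` preserves it, `κ` factors through `Q v`, and the factor is `u`. The counit law gives the
identity for `w`, and coassociativity the one for `τ`. -/
theorem exists_of_leftComodule (M : H.comonadC.Coalgebra) :
    ∃ (Y : B) (u : M.A ⟶ H.Q.obj Y) (v : Y ⟶ H.P.obj M.A),
      u ≫ H.Q.map v = M.a ≫ H.i.app M.A ∧
      u ≫ H.Q.map v ≫ H.w.app M.A = H.r.app M.A ∧
      v ≫ H.P.map u ≫ H.z.app Y = H.s.app Y ∧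
      u ≫ H.τ.app Y = u ≫ H.Q.map v ≫ H.Q.map (H.P.map u) := by
  obtain ⟨X, σ, counit, coassoc⟩ := M
  change X ⟶ H.C.obj X at σ
  replace counit : σ ≫ H.εC X = 𝟙 X := counit
  replace coassoc : σ ≫ H.δC X = σ ≫ H.C.map σ := coassoc
  let κ : X ⟶ H.Q.obj (H.P.obj X) := σ ≫ H.i.app X
  have hκw : κ ≫ H.w.app X = H.r.app X := by
    have h := H.εC_r X
    rw [Category.assoc, ← h, reassoc_of% counit]
  have hκτ : κ ≫ H.τ.app (H.P.obj X) = κ ≫ H.Q.map (H.P.map κ) := by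
    have h2 := H.c_naturality_δ X
    have h3 := H.i_naturality σ
    have h4 := H.i_naturality (H.i.app X)
    simp only [κ, Category.assoc, Functor.map_comp, Functor.comp_obj] at h2 h3 h4 ⊢
    rw [← h2, reassoc_of% coassoc, h4, reassoc_of% h3]
  have e := isEqualizer_ι _ _ (H.s.app (H.P.obj X)) (H.P.map κ ≫ H.z.app (H.P.obj X))
  let Y := equalizer (H.s.app (H.P.obj X)) (H.P.map κ ≫ H.z.app (H.P.obj X))
  let v : Y ⟶ H.P.obj X := equalizer.ι _ _
  have hv : v ≫ H.s.app (H.P.obj X) = v ≫ H.P.map κ ≫ H.z.app (H.P.obj X) := e.condition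
  -- Coassociativity trades `QP κ` for `τ` after `κ`, and `(Q z) ∘ τ = Q s` finishes.
  have hκ : κ ≫ H.Q.map (H.s.app (H.P.obj X)) =
      κ ≫ H.Q.map (H.P.map κ ≫ H.z.app (H.P.obj X)) := by
    have h1 := H.τ_z (H.P.obj X)
    rw [H.Q.map_comp, ← reassoc_of% hκτ, h1]
  let u : X ⟶ H.Q.obj Y := (e.map H.Q).lift κ hκ
  have hu : u ≫ H.Q.map v = κ := (e.map H.Q).lift_comp κ hκ
  refine ⟨Y, u, v, hu, ?_, ?_, ?_⟩
  · rw [reassoc_of% hu, hκw]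
  · apply (e.map H.S).cancel
    change (v ≫ H.P.map u ≫ H.z.app Y) ≫ H.S.map v = H.s.app Y ≫ H.S.map v
    have h1 := H.z_naturality v
    have h2 := H.s_naturality v
    have h3 := congrArg H.P.map hu
    simp only [Category.assoc, Functor.map_comp, Functor.comp_obj, Functor.id_obj]
      at h1 h2 h3 hv ⊢
    rw [← h1, reassoc_of% h3, ← hv, h2]
  · apply (((e.map H.Q).map H.P).map H.Q).cancel
    change (u ≫ H.τ.app Y) ≫ H.Q.map (H.P.map (H.Q.map v)) =
      (u ≫ H.Q.map v ≫ H.Q.map (H.P.map u)) ≫ H.Q.map (H.P.map (H.Q.map v))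
    have h1 := H.τ_naturality v
    have h3 := congrArg (fun t => H.Q.map (H.P.map t)) hu
    simp only [Category.assoc, Functor.map_comp, Functor.comp_obj] at h1 h3 hκτ ⊢
    rw [← h1, reassoc_of% hu, hκτ, h3, reassoc_of% hu]

instance : (toLeft H).EssSurj where
  mem_essImage M := by
    obtain ⟨Y, u, v, huv, h1, h2, h3⟩ := exists_of_leftComodule M
    let E : H.Context := ⟨M.A, Y, u, v, h1, h2, h3⟩
    -- A coaction is determined by its composite with the monomorphism `i`.
    have hσ : E.σ = M.a := (H.isEqualizer_i _).cancel (E.σ_i.trans huv)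
    refine ⟨E, ⟨Comonad.Coalgebra.isoMk (Iso.refl _) ?_⟩⟩
    change E.σ ≫ H.comonadC.map (𝟙 M.A) = 𝟙 M.A ≫ M.a
    rw [hσ]
    exact (congrArg (fun t => M.a ≫ t) (H.comonadC.map_id M.A)).trans
      ((Category.comp_id _).trans (Category.id_comp _).symm)

/-- The object `X` is a cotensor product: the equalizer of the coaction `d` of `D` on `Q` and of `Q
ρ`. As `Q j` is monic and `τ = (Q j) ∘ d`, this is the equalizer prescribed by `isEqualizer_u`.
Since `P` preserves it, `κ` factors through `P u`, and the factor is `v`. -/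
theorem exists_of_rightComodule (M : H.comonadD.Coalgebra) :
    ∃ (X : A) (u : X ⟶ H.Q.obj M.A) (v : M.A ⟶ H.P.obj X),
      v ≫ H.P.map u = M.a ≫ H.j.app M.A ∧
      u ≫ H.Q.map v ≫ H.w.app X = H.r.app X ∧
      v ≫ H.P.map u ≫ H.z.app M.A = H.s.app M.A ∧
      u ≫ H.τ.app M.A = u ≫ H.Q.map v ≫ H.Q.map (H.P.map u) := by
  obtain ⟨Y, ρ, counit, coassoc⟩ := M
  change Y ⟶ H.D.obj Y at ρ
  replace counit : ρ ≫ H.εD Y = 𝟙 Y := counit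
  replace coassoc : ρ ≫ H.δD Y = ρ ≫ H.D.map ρ := coassoc
  let κ : Y ⟶ H.P.obj (H.Q.obj Y) := ρ ≫ H.j.app Y
  have hκz : κ ≫ H.z.app Y = H.s.app Y := by
    have h := H.εD_s Y
    rw [Category.assoc, ← h, reassoc_of% counit]
  -- Coassociativity of `ρ`, composed with `j` at `DY`.
  have hκd : κ ≫ H.P.map (H.d Y) = κ ≫ H.P.map (H.Q.map ρ) := by
    have h1 := H.δD_j Y
    have h2 := H.j_naturality ρ
    simp only [κ, Category.assoc]
    rw [← h1, reassoc_of% coassoc, h2]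
  have e := isEqualizer_ι _ _ (H.d Y) (H.Q.map ρ)
  let X := equalizer (H.d Y) (H.Q.map ρ)
  let u : X ⟶ H.Q.obj Y := equalizer.ι _ _
  have hud : u ≫ H.d Y = u ≫ H.Q.map ρ := e.condition
  let v : Y ⟶ H.P.obj X := (e.map H.P).lift κ hκd
  have hv : v ≫ H.P.map u = κ := (e.map H.P).lift_comp κ hκd
  have huτ : u ≫ H.τ.app Y = u ≫ H.Q.map v ≫ H.Q.map (H.P.map u) := by
    have h1 := H.d_Qj Y
    rw [← h1, reassoc_of% hud, ← H.Q.map_comp, ← H.Q.map_comp, hv]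
  refine ⟨X, u, v, hv, ?_, ?_, huτ⟩
  -- After the monomorphism `R u` the claim reduces to `w ∘ τ = r`.
  · apply (e.map H.R).cancel
    change (u ≫ H.Q.map v ≫ H.w.app X) ≫ H.R.map u = H.r.app X ≫ H.R.map u
    have h1 := H.w_naturality u
    have h2 := H.r_naturality u
    have h3 := H.τ_w Y
    simp only [Category.assoc, Functor.comp_obj, Functor.id_obj] at h1 h2 h3 huτ ⊢
    rw [← h1, ← reassoc_of% huτ, h3, h2]
  · rw [reassoc_of% hv, hκz]

instance : (toRight H).EssSurj where
  mem_essImage M := by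
    obtain ⟨X, u, v, huv, h1, h2, h3⟩ := exists_of_rightComodule M
    let E : H.Context := ⟨X, M.A, u, v, h1, h2, h3⟩
    have hρ : E.ρ = M.a := (H.isEqualizer_j _).cancel (E.ρ_j.trans huv)
    refine ⟨E, ⟨Comonad.Coalgebra.isoMk (Iso.refl _) ?_⟩⟩
    change E.ρ ≫ H.comonadD.map (𝟙 M.A) = 𝟙 M.A ≫ M.a
    rw [hρ]
    exact (congrArg (fun t => M.a ≫ t) (H.comonadD.map_id M.A)).trans
      ((Category.comp_id _).trans (Category.id_comp _).symm)

end EssSurj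

end Context

/-! ### The equivalence of comodule categories -/

section Equivalence

variable [HasEqualizers A] [HasEqualizers B]

open Context

instance (H : Setting A B) : (toLeft H).IsEquivalence where

instance (H : Setting A B) : (toRight H).IsEquivalence where

/-- The categories of `C`-comodules and of `D`-comodules are equivalent, through contexts. -/
noncomputable def comoduleEquivalence (H : Setting A B) : H.comonadC.Coalgebra ≌ H.comonadD.Coalgebra :=
  (toLeft H).asEquivalence.symm.trans (toRight H).asEquivalence

end Equivalence

end Setting

end PreTorsors

theorem corollary5p4 {A : Type u₁} [Category.{v₁} A] {B : Type u₂} [Category.{v₂} B]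
    {T : Type u₃} [Category.{v₃} T] [HasEqualizers A] [HasEqualizers B]
    {NA : A ⥤ T} {RA : T ⥤ A} {NB : B ⥤ T} {RB : T ⥤ B}
    (adjA : NA ⊣ RA) (adjB : NB ⊣ RB)
    (hA : PreTorsors.IsRegularAdjunction adjA) (hB : PreTorsors.IsRegularAdjunction adjB)
    (X : PreTorsors.PreTorsor adjA adjB) :
    Nonempty ((X.toRegularObject hA hB).comonad.Coalgebra ≌
      (X.toCoregularObject hA hB).comonad.Coalgebra) := by
  -- Both associated comonads are by definition those of the setting of `X`.
  exact ⟨(X.setting hA hB).comoduleEquivalence⟩
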